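/- Let $\mathfrak M$ be a saturated model of a complete first-order (possibly multi-sorted) theory, let $A\subseteq\mathfrak M$ with $|A|<|\mathfrak M|$, let $p\in S_k(A)$ be a complete type in finitely many variables, and let $p(\mathfrak M)$ be its set of realizations. A subset of $p(\mathfrak M)$, or a binary relation on $p(\mathfrak M)$, is relatively $B$-definable if it is the trace on $p(\mathfrak M)$, respectively on $p(\mathfrak M)^2$, of a $B$-definable set; relatively definable means relatively $\mathfrak M$-definable. Let $<$ be a relatively $A$-definable (strict) linear order on $p(\mathfrak M)$ such that $(p,<)$ is a weakly o-minimal pair over $A$, i.e. every relatively definable subset of $p(\mathfrak M)$ has finitely many $<$-convex components (maximal convex subsets). Let $\mathcal E_p$ be the set of relatively $A$-definable equivalence relations on $p(\mathfrak M)$. For a linear order $\prec$ and a $\prec$-convex equivalence relation $E$ put $$x\prec_E y \iff (E(x,y)\wedge y\prec x)\vee(\neg E(x,y)\wedge x\prec y),$$ and for a sequence $\vec E=(E_0,\dots,E_n)$ of pairwise $\subseteq$-comparable $<$-convex equivalence relations put ${<_{\vec E}}=(\dots((<_{E_0})_{E_1})\dots)_{E_n}$. A linear order $\triangleleft$ on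 $p(\mathfrak M)$ has the same orientation as $<$ if for some $a\in p(\mathfrak M)$ the set $\{x\in p(\mathfrak M): a\triangleleft x\}$ contains a non-empty final part of $(p(\mathfrak M),<)$. Let $\triangleleft$ be any relatively $A$-definable linear order on $p(\mathfrak M)$. Then there is a unique strictly increasing sequence $\vec E=(E_0,E_1,\dots,E_n)$ (with $n\ge 0$ also unique) of members of $\mathcal E_p$, all of which are $<$-convex, such that $E_0=\mathrm{id}_{p(\mathfrak M)}$ and $\triangleleft={<_{\vec E}}$. Moreover, $<$ and $\triangleleft$ have the same orientation if and only if $E_n\neq p(\mathfrak M)^2$. -/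

import Mathlib

open FirstOrder
universe u v w x

namespace WeaklyOMinimal

/-! ### Linear orders -/

section Orders

variable {X : Type*}

/-- `D` is convex with respect to the strict linear order `lt`. -/
def IsConvex (lt : X → X → Prop) (D : Set X) : Prop :=
  ∀ ⦃a b c : X⦄, a ∈ D → b ∈ D → lt a c → lt c b → c ∈ D

/-- The convex components of `D`: the maximal convex subsets of `D`. -/
def convexComponents (lt : X → X → Prop) (D : Set X) : Set (Set X) :=
  {C | Maximal (fun C' : Set X => C' ⊆ D ∧ IsConvex lt C') C}

/-- `D` is a final part of `(X, lt)`. -/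
def IsFinalPart (lt : X → X → Prop) (D : Set X) : Prop :=
  ∀ ⦃a b : X⦄, a ∈ D → lt a b → b ∈ D

/-- `D` is a right-eventual part of `(X, lt)`: it contains a non-empty final part. -/
def IsRightEventual (lt : X → X → Prop) (D : Set X) : Prop :=
  ∃ F : Set X, F.Nonempty ∧ IsFinalPart lt F ∧ F ⊆ D

/-- The equivalence relation `E` is convex: all its classes are convex. -/
def IsConvexEquiv (lt : X → X → Prop) (E : Setoid X) : Prop :=
  ∀ a : X, IsConvex lt {x | E x a}

/-- The order `<_E`, which reverses `<` inside every `E`-class and keeps it between elements of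
different classes. -/
def ltE (lt : X → X → Prop) (E : Setoid X) (x y : X) : Prop :=
  (E x y ∧ lt y x) ∨ (¬ E x y ∧ lt x y)

/-- The order `<_(E₁, …, E_m) = (… ((<_E₁)_E₂) …)_E_m`. -/
def ltSeq (lt : X → X → Prop) (Es : List (Setoid X)) : X → X → Prop :=
  Es.foldl ltE lt

end Orders

/-! ### Saturated models, types, relative definability -/

section Types

variable (L : FirstOrder.Language.{u, v}) {M : Type w} [L.Structure M]

/-- `M` is a saturated model, possibly of a multi-sorted theory.

A multi-sorted structure is given as usual by the disjoint union `M` of its sorts together with the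
map `sort` assigning to every element its sort, each sort being `∅`-definable; the one-sorted case
is the one where `S` has a single element. Saturation: for every set `A ⊆ M` with `|A| < |M|`,
every set of `L_A`-formulas in one variable of some sort that is finitely satisfiable in `M` is
realized in `M`. -/
structure IsSaturated {S : Type*} (sort : M → S) : Prop where
  definable_sort : ∀ s : S, (∅ : Set M).Definable L {v : Unit → M | sort (v ()) = s}
  realize : ∀ A : Set M, Cardinal.mk A < Cardinal.mk M →
    ∀ (s : S) (Γ : Set (L[[A]].Formula Unit)),
      (∀ Γ₀ : Finset (L[[A]].Formula Unit), (Γ₀ : Set (L[[A]].Formula Unit)) ⊆ Γ →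
        ∃ a : M, sort a = s ∧ ∀ φ ∈ Γ₀, φ.Realize (fun _ : Unit => a)) →
      ∃ a : M, sort a = s ∧ ∀ φ ∈ Γ, φ.Realize (fun _ : Unit => a)

/-- The space `S_n(A)` of complete `n`-types over the parameter set `A ⊆ M`. -/
abbrev TypeSpace (A : Set M) (n : ℕ) :=
  (L[[A]].completeTheory M).CompleteType (Fin n)

variable {L}
variable {A : Set M} {n : ℕ}

/-- The set `p(M)` of realizations of the type `p` in `M`. -/
def locus (p : TypeSpace L A n) : Set (Fin n → M) :=
  {v | ∀ φ : L[[A]].Formula (Fin n), FirstOrder.Language.Formula.equivSentence φ ∈ p → φ.Realize v}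

/-- A subset of `p(M)` is relatively `B`-definable. -/
def RelDefinableSet (p : TypeSpace L A n) (B : Set M) (X : Set (locus p)) : Prop :=
  ∃ D : Set (Fin n → M), B.Definable L D ∧ ∀ x : locus p, x ∈ X ↔ x.1 ∈ D

/-- A binary relation on `p(M)` is relatively `B`-definable. -/
def RelDefinableRel (p : TypeSpace L A n) (B : Set M) (R : locus p → locus p → Prop) : Prop :=
  ∃ D : Set (Fin n ⊕ Fin n → M), B.Definable L D ∧
    ∀ x y : locus p, R x y ↔ Sum.elim x.1 y.1 ∈ D

/-- `lt` is a relatively `A`-definable (strict) linear order on `p(M)`, where `p ∈ S_n(A)`. -/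
structure IsRelDefinableLinearOrder (p : TypeSpace L A n) (lt : locus p → locus p → Prop) :
    Prop where
  isStrictTotalOrder : IsStrictTotalOrder (locus p) lt
  relDefinable : RelDefinableRel p A lt

/-- `(p, lt)` is a weakly o-minimal pair over `A`: `lt` is a relatively `A`-definable linear order
on `p(M)`, and every subset of `p(M)` that is relatively definable (with any parameters) has
finitely many convex components. -/
structure IsWeaklyOMinimalPair (p : TypeSpace L A n) (lt : locus p → locus p → Prop) :
    Prop where
  linearOrder : IsRelDefinableLinearOrder p lt
  finite_components : ∀ D : Set (locus p), RelDefinableSet p Set.univ D →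
    (convexComponents lt D).Finite

/-- `𝓔_p`, the set of all relatively `A`-definable equivalence relations on `p(M)`. -/
def relDefinableEquivs (p : TypeSpace L A n) : Set (Setoid (locus p)) :=
  {E | RelDefinableRel p A (fun x y => E x y)}

/-- The order `tri` has the same orientation as `lt`: for some realization `a` of `p`, the set of
all `x` with `a ◁ x` is a right-eventual part of `(p(M), lt)`. -/
def SameOrientation (p : TypeSpace L A n) (tri lt : locus p → locus p → Prop) : Prop :=
  ∃ a : locus p, IsRightEventual lt {x | tri a x}

/-- `(E₀, …, E_m)` is a strictly increasing sequence of members of `𝓔_p` with `E₀` the identity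
relation, and `tri` is the order `<_(E₀, …, E_m)`. -/
structure Represents (p : TypeSpace L A n) (lt tri : locus p → locus p → Prop) {m : ℕ}
    (E : Fin (m + 1) → Setoid (locus p)) : Prop where
  strictMono : StrictMono E
  mem : ∀ i, E i ∈ relDefinableEquivs p
  zero : E 0 = ⊥
  eq_ltSeq : tri = ltSeq lt (List.ofFn E)

end Types

end WeaklyOMinimal

/-! Write `F(a)` for `rightAgreement lt tri a`: the largest final part of `(p(M), <)` to the right
of `a` whose points are all above `a` for `◁`. If `◁` is `<_(E₀, …, E_n)`, then `F(a)` is the set of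
points to the right of `a` outside the `E_n`-class of `a`, because the last reversal makes the far
end of that class disagree with `<`. So `E_n` can be read off from the two orders, and `lastEquiv`,
equality of the sets `F(a)`, is the candidate for it when no sequence is given.

The main point is regularity (`IsRegular`): if `a < z` and `z ∉ F(a)`, then `F(a) = F(z)`. By weak
o-minimality, `{x | a ◁ x}` is eventually constant on the part of `p(M)` to the right of `a` outside
`F(a)`, and its eventual value there must be "no". A failure of regularity therefore yields a
`NestedAgreement` pair. By homogeneity every point then starts such a pair, and iterating gives a
relatively definable set with infinitely many convex components.

Regularity makes `lastEquiv` convex and relatively `A`-definable, with `◁` equal to `<` between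
distinct classes. Reversing `◁` inside these classes gives a new relatively `A`-definable order with
strictly smaller last relation (`lastEquiv_ltE_lt`), unless that relation was the identity. An
infinite descent would make `{x | a ◁ x}` alternate infinitely often
(`convexComponents_infinite_of_descent`), so the process ends at `<`. Reversal is an involution, so
undoing the steps represents `◁`. Uniqueness peels off the last relation and inducts, and
orientation is preserved exactly when some `F(a)` is non-empty.

Definability needs care because `F` quantifies over `p(M)`, which need not be definable. It is
handled by `IsInvariant.relDefinableRel`: invariance under types over `A`, plus fibers definable
with extra parameters, gives definability over `A`. -/

namespace WeaklyOMinimal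

open Set

/-! ### Saturation for families of definable sets -/

section Saturation

variable {L : FirstOrder.Language.{u, v}} {M : Type w} [L.Structure M]

/-- A parameter set over which a saturated model realizes types in finitely many variables. -/
def IsSmall (B : Set M) : Prop :=
  Finite M ∨ Cardinal.mk B < Cardinal.mk M

/-- In a finite structure, adjoining parameters can destroy `|B| < |M|`; the finite disjunct of
`IsSmall` absorbs this case, where types are realized for trivial reasons. -/
theorem IsSmall.union_finite {B C : Set M} (hB : IsSmall B) (hC : C.Finite) :
    IsSmall (B ∪ C) := by
  rcases finite_or_infinite M with h | h
  · exact Or.inl h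
  · rcases hB with hB | hB
    · exact (not_finite M).elim
    · refine Or.inr ((Cardinal.mk_union_le _ _).trans_lt ?_)
      exact Cardinal.add_lt_of_lt (Cardinal.aleph0_le_mk M) hB
        ((Cardinal.lt_aleph0_iff_set_finite.2 hC).trans_le (Cardinal.aleph0_le_mk M))

theorem definable_fiber {α β : Type*} [Finite α] [Finite β] {A : Set M} {D : Set (α ⊕ β → M)}
    (hD : A.Definable L D) (c : α → M) :
    (A ∪ range c).Definable L {x : β → M | Sum.elim c x ∈ D} := by
  have h : (A ∪ range c).DefinableMap L (fun x : β → M => Sum.elim c x) := by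
    rintro (i | j)
    · exact L.definableFun_const _ (Or.inr ⟨i, rfl⟩)
    · exact DefinableFun.proj L
  exact (hD.mono subset_union_left).preimage_map h

variable {S : Type x} {sort : M → S}

theorem IsSaturated.definable_box (hM : IsSaturated L sort) (B : Set M) {ι : Type*} [Finite ι]
    (s : ι → S) : B.Definable L {v : ι → M | ∀ i, sort (v i) = s i} := by
  rw [ofPred_forall]
  exact definable_iInter_of_finite fun i =>
    ((hM.definable_sort (s i)).mono (empty_subset B)).preimage_comp fun _ : Unit => i

theorem IsSaturated.exists_forall_mem_unit (hM : IsSaturated L sort) {B : Set M}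
    (hB : Cardinal.mk B < Cardinal.mk M) {I : Type*} (s : S) (f : I → Set (Unit → M))
    (hf : ∀ i, B.Definable L (f i))
    (h : ∀ T : Finset I, ∃ a : M, sort a = s ∧ ∀ i ∈ T, (fun _ => a) ∈ f i) :
    ∃ a : M, sort a = s ∧ ∀ i, (fun _ => a) ∈ f i := by
  classical
  choose φ hφ using hf
  have key : ∀ i a, (fun _ => a) ∈ f i ↔ (φ i).Realize fun _ : Unit => a := by
    intro i a
    rw [hφ i, mem_ofPred_eq]
  obtain ⟨a, ha, h'⟩ := hM.realize B hB s (range φ) fun Γ₀ hΓ => by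
    choose g hg using fun ψ : Γ₀ => hΓ ψ.2
    obtain ⟨a, ha, h'⟩ := h (Finset.univ.image g)
    refine ⟨a, ha, fun ψ hψ => ?_⟩
    have := (key _ a).1 (h' _ (Finset.mem_image_of_mem g (Finset.mem_univ ⟨ψ, hψ⟩)))
    rwa [hg] at this
  exact ⟨a, ha, fun i => (key i a).2 (h' _ ⟨i, rfl⟩)⟩

theorem IsSaturated.exists_forall_mem_fin (hM : IsSaturated L sort) [Infinite M] {I : Type*}
    {k : ℕ} : ∀ {B : Set M} (_ : Cardinal.mk B < Cardinal.mk M)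
    (s : Fin k → S) (f : I → Set (Fin k → M)) (_ : ∀ i, B.Definable L (f i))
    (_ : ∀ T : Finset I, ∃ v, (∀ j, sort (v j) = s j) ∧ ∀ i ∈ T, v ∈ f i),
    ∃ v, (∀ j, sort (v j) = s j) ∧ ∀ i, v ∈ f i := by
  induction k with
  | zero =>
    intro B _ s f _ h
    refine ⟨Fin.elim0, fun j => j.elim0, fun i => ?_⟩
    obtain ⟨v, -, hv⟩ := h {i}
    rw [Subsingleton.elim Fin.elim0 v]
    exact hv i (Finset.mem_singleton_self i)
  | succ k ih =>
    intro B hB s f hf h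
    classical
    let e : Fin (k + 1) → Unit ⊕ Fin k := Fin.cases (Sum.inl ()) Sum.inr
    have he : ∀ (a : M) (u : Fin k → M),
        Sum.elim (fun _ : Unit => a) u ∘ e = Fin.cons a u := by
      intro a u
      ext j
      refine Fin.cases ?_ (fun j => ?_) j <;> simp [e]
    -- The first coordinate realizes the projections of all finite intersections, so the remaining
    -- coordinates form a finitely satisfiable problem over `B ∪ {a}`.
    obtain ⟨a, ha, h'⟩ := hM.exists_forall_mem_unit hB (s 0)
      (fun T : Finset I => {w : Unit → M | ∃ u : Fin k → M, Sum.elim w u ∈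
        ((fun w => w ∘ Sum.inr) ⁻¹' {u : Fin k → M | ∀ j, sort (u j) = s j.succ} ∩
          ⋂ i ∈ T, (fun w => w ∘ e) ⁻¹' f i)})
      (fun T => (((hM.definable_box B _).preimage_comp _).inter
        (definable_biInter_finset (fun i => (hf i).preimage_comp e) T)).exists_of_finite)
      (fun T => by
        obtain ⟨v, hv, hv'⟩ := h (T.biUnion id)
        refine ⟨v 0, hv 0, fun T' hT' => ⟨Fin.tail v, fun j => hv j.succ, ?_⟩⟩
        simp only [mem_iInter, mem_preimage, he, Fin.cons_self_tail]
        exact fun i hi => hv' i (Finset.mem_biUnion.2 ⟨T', hT', hi⟩))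
    have hB' : Cardinal.mk ↥(B ∪ range fun _ : Unit => a) < Cardinal.mk M :=
      (IsSmall.union_finite (Or.inr hB) (finite_range _)).resolve_left
        (not_finite_iff_infinite.2 ‹_›)
    obtain ⟨u, hu, hu'⟩ := ih hB' (fun j => s j.succ)
      (fun i => {u : Fin k → M | Sum.elim (fun _ : Unit => a) u ∈ (fun w => w ∘ e) ⁻¹' f i})
      (fun i => definable_fiber ((hf i).preimage_comp e) _)
      (fun T => by
        obtain ⟨u, hu, hu'⟩ := h' T
        exact ⟨u, hu, fun i hi => mem_iInter₂.1 hu' i hi⟩)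
    refine ⟨Fin.cons a u, fun j => ?_, fun i => ?_⟩
    · refine Fin.cases ?_ (fun j => ?_) j
      · exact ha
      · exact hu j
    · have := hu' i
      rwa [mem_ofPred_eq, mem_preimage, he] at this

/-- In a saturated model, a family of definable sets of tuples over a small set of parameters that
has the finite intersection property within given sorts has a common element. -/
theorem IsSaturated.exists_forall_mem (hM : IsSaturated L sort) {B : Set M} (hB : IsSmall B)
    {I : Type*} {ι : Type*} [Finite ι] (s : ι → S) (f : I → Set (ι → M))
    (hf : ∀ i, B.Definable L (f i))
    (h : ∀ T : Finset I, ∃ v, (∀ j, sort (v j) = s j) ∧ ∀ i ∈ T, v ∈ f i) :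
    ∃ v, (∀ j, sort (v j) = s j) ∧ ∀ i, v ∈ f i := by
  classical
  rcases finite_or_infinite M with hfin | hinf
  · rcases isEmpty_or_nonempty I with hI | hI
    · obtain ⟨v, hv, -⟩ := h ∅
      exact ⟨v, hv, isEmptyElim⟩
    by_contra! hc
    choose! g hg using hc
    have := Fintype.ofFinite (ι → M)
    obtain ⟨v, hv, hv'⟩ := h (Finset.univ.image g)
    exact hg v hv (hv' _ (Finset.mem_image_of_mem g (Finset.mem_univ v)))
  · obtain ⟨k, ⟨e⟩⟩ := Finite.exists_equiv_fin ι
    obtain ⟨v, hv, hv'⟩ := hM.exists_forall_mem_fin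
      (hB.resolve_left (not_finite_iff_infinite.2 hinf)) (s ∘ e.symm)
      (fun i => (fun w : Fin k → M => w ∘ e) ⁻¹' f i) (fun i => (hf i).preimage_comp e)
      (fun T => by
        obtain ⟨v, hv, hv'⟩ := h T
        refine ⟨v ∘ e.symm, fun j => hv _, fun i hi => ?_⟩
        rw [mem_preimage, Function.comp_assoc, e.symm_comp_self]
        exact hv' i hi)
    exact ⟨v ∘ e, fun j => by simpa using hv (e j), hv'⟩

end Saturation

/-! ### Equality of types -/

section SameType

variable (L : FirstOrder.Language.{u, v}) {M : Type w} [L.Structure M]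

/-- The tuples `x` and `y` have the same type over `A`. -/
def SameType (A : Set M) {α : Type*} (x y : α → M) : Prop :=
  ∀ D : Set (α → M), A.Definable L D → (x ∈ D ↔ y ∈ D)

variable {L} {A : Set M}

theorem SameType.of_imp {α : Type*} {x y : α → M}
    (h : ∀ D : Set (α → M), A.Definable L D → x ∈ D → y ∈ D) : SameType L A x y :=
  fun D hD => ⟨h D hD, fun hy => by
    by_contra hx
    exact h Dᶜ hD.compl hx hy⟩

theorem SameType.symm {α : Type*} {x y : α → M} (h : SameType L A x y) : SameType L A y x :=
  fun D hD => (h D hD).symm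

theorem SameType.comp {α β : Type*} {x y : α → M} (h : SameType L A x y) (f : β → α) :
    SameType L A (x ∘ f) (y ∘ f) :=
  fun _ hD => h _ (hD.preimage_comp f)

/-- Homogeneity of saturated models. -/
theorem SameType.exists_sumElim {S : Type x} {sort : M → S} (hM : IsSaturated L sort)
    (hA : IsSmall A) {α β : Type*} [Finite α] [Finite β] {x y : α → M} (h : SameType L A x y)
    (c : β → M) : ∃ d : β → M, SameType L A (Sum.elim x c) (Sum.elim y d) := by
  obtain ⟨d, -, hd⟩ := hM.exists_forall_mem (hA.union_finite (finite_range y))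
    (fun j => sort (c j))
    (fun D : {D : Set (α ⊕ β → M) // A.Definable L D ∧ Sum.elim x c ∈ D} =>
      {d : β → M | Sum.elim y d ∈ D.1})
    (fun D => definable_fiber D.2.1 y)
    (fun T => by
      -- Projecting a finite intersection gives an `A`-definable condition true of `x`, hence of
      -- `y`. The sort box is included so that the new witness has the sorts of `c`.
      have hdef := ((((hM.definable_box A fun j => sort (c j)).preimage_comp
        (Sum.inr : β → α ⊕ β)).inter
        (definable_biInter_finset (fun D : {D : Set (α ⊕ β → M) //
          A.Definable L D ∧ Sum.elim x c ∈ D} => D.2.1) T)).exists_of_finite)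
      obtain ⟨d, hd, hd'⟩ := (h _ hdef).1
        ⟨c, fun _ => rfl, mem_iInter₂.2 fun D _ => D.2.2⟩
      exact ⟨d, hd, fun D hD => mem_iInter₂.1 hd' D hD⟩)
  exact ⟨d, SameType.of_imp fun D hD hx => hd ⟨D, hD, hx⟩⟩

end SameType

section Locus

variable {L : FirstOrder.Language.{u, v}} {M : Type w} [L.Structure M] {A : Set M} {n : ℕ}
  {p : TypeSpace L A n}

/-! ### Relatively definable sets and relations -/

theorem mem_locus_congr {v w : Fin n → M} (h : SameType L A v w) :
    v ∈ locus p ↔ w ∈ locus p :=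
  forall₂_congr fun φ _ => h _ ⟨φ, rfl⟩

theorem sameType_of_mem_locus (a b : locus p) : SameType L A a.1 b.1 := by
  refine SameType.of_imp ?_
  rintro D ⟨φ, rfl⟩ ha
  rcases p.mem_or_not_mem (Language.Formula.equivSentence φ) with h | h
  · exact b.2 φ h
  · exact absurd ha (a.2 φ.not h)

theorem RelDefinableRel.compl {B : Set M} {R : locus p → locus p → Prop}
    (h : RelDefinableRel p B R) : RelDefinableRel p B fun x y => ¬ R x y := by
  obtain ⟨D, hD, h⟩ := h
  exact ⟨Dᶜ, hD.compl, fun x y => not_congr (h x y)⟩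

theorem RelDefinableRel.and {B : Set M} {R R' : locus p → locus p → Prop}
    (h : RelDefinableRel p B R) (h' : RelDefinableRel p B R') :
    RelDefinableRel p B fun x y => R x y ∧ R' x y := by
  obtain ⟨D, hD, h⟩ := h
  obtain ⟨D', hD', h'⟩ := h'
  exact ⟨D ∩ D', hD.inter hD', fun x y => and_congr (h x y) (h' x y)⟩

theorem RelDefinableRel.or {B : Set M} {R R' : locus p → locus p → Prop}
    (h : RelDefinableRel p B R) (h' : RelDefinableRel p B R') :
    RelDefinableRel p B fun x y => R x y ∨ R' x y := by
  obtain ⟨D, hD, h⟩ := h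
  obtain ⟨D', hD', h'⟩ := h'
  exact ⟨D ∪ D', hD.union hD', fun x y => or_congr (h x y) (h' x y)⟩

theorem RelDefinableRel.swap {B : Set M} {R : locus p → locus p → Prop}
    (h : RelDefinableRel p B R) : RelDefinableRel p B fun x y => R y x := by
  obtain ⟨D, hD, h⟩ := h
  refine ⟨_, hD.preimage_comp Sum.swap, fun x y => ?_⟩
  refine (h y x).trans ?_
  rw [mem_preimage, Sum.elim_swap]

theorem RelDefinableRel.setOf_right {R : locus p → locus p → Prop}
    (h : RelDefinableRel p A R) (a : locus p) : RelDefinableSet p univ {x | R a x} := by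
  obtain ⟨D, hD, h⟩ := h
  exact ⟨_, (definable_fiber hD a.1).mono (subset_univ _), fun x => h a x⟩

theorem RelDefinableRel.setOf_left {R : locus p → locus p → Prop}
    (h : RelDefinableRel p A R) (a : locus p) : RelDefinableSet p univ {x | R x a} :=
  h.swap.setOf_right a

theorem RelDefinableSet.inter {B : Set M} {X Y : Set (locus p)} (hX : RelDefinableSet p B X)
    (hY : RelDefinableSet p B Y) : RelDefinableSet p B (X ∩ Y) := by
  obtain ⟨D, hD, h⟩ := hX
  obtain ⟨D', hD', h'⟩ := hY
  exact ⟨D ∩ D', hD.inter hD', fun x => and_congr (h x) (h' x)⟩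

/-! ### Invariant relations -/

/-- The tuples `x` and `y` of realizations of `p` have the same type over `A`. -/
def Sim {k : ℕ} (x y : Fin k → locus p) : Prop :=
  SameType L A (fun q : Fin k × Fin n => (x q.1).1 q.2) (fun q => (y q.1).1 q.2)

theorem Sim.symm {k : ℕ} {x y : Fin k → locus p} (h : Sim x y) : Sim y x :=
  SameType.symm h

theorem sim_singleton (a b : locus p) : Sim ![a] ![b] := by
  have key : ∀ c : locus p,
      (fun q : Fin 1 × Fin n => (![c] q.1).1 q.2) = c.1 ∘ Prod.snd := by
    rintro c
    ext ⟨i, t⟩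
    fin_cases i
    rfl
  rw [Sim, key, key]
  exact (sameType_of_mem_locus a b).comp _

theorem Sim.rel {k : ℕ} {x y : Fin k → locus p} (h : Sim x y) {R : locus p → locus p → Prop}
    (hR : RelDefinableRel p A R) (i j : Fin k) : R (x i) (x j) ↔ R (y i) (y j) := by
  obtain ⟨D, hD, hR⟩ := hR
  have key : ∀ z : Fin k → locus p, Sum.elim (z i).1 (z j).1 =
      (fun q : Fin k × Fin n => (z q.1).1 q.2) ∘ Sum.elim (fun t => (i, t)) (fun t => (j, t)) := by
    intro z
    ext (t | t) <;> rfl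
  rw [hR, hR, key, key]
  exact h.comp _ D hD

theorem Sim.exists_cons {S : Type x} {sort : M → S} (hM : IsSaturated L sort) (hA : IsSmall A)
    {k : ℕ} {x y : Fin k → locus p} (h : Sim x y) (c : locus p) :
    ∃ d, Sim (Matrix.vecCons c x) (Matrix.vecCons d y) := by
  obtain ⟨d, hd⟩ := h.exists_sumElim hM hA c.1
  have hd' : d ∈ locus p := (mem_locus_congr (hd.comp Sum.inr)).1 c.2
  refine ⟨⟨d, hd'⟩, ?_⟩
  let f : Fin (k + 1) × Fin n → (Fin k × Fin n) ⊕ Fin n :=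
    fun q => Fin.cases (Sum.inr q.2) (fun i => Sum.inl (i, q.2)) q.1
  have key : ∀ (e : locus p) (z : Fin k → locus p),
      (fun q : Fin (k + 1) × Fin n => (Matrix.vecCons e z q.1).1 q.2) =
        Sum.elim (fun q : Fin k × Fin n => (z q.1).1 q.2) e.1 ∘ f := by
    rintro e z
    ext ⟨i, t⟩
    refine Fin.cases ?_ (fun i => ?_) i <;> simp [f]
  rw [Sim, key, key]
  exact hd.comp f

/-- `P` depends only on the type over `A` of a tuple of realizations of `p`. -/
def IsInvariant {k : ℕ} (P : (Fin k → locus p) → Prop) : Prop :=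
  ∀ x y, Sim x y → P x → P y

theorem IsInvariant.iff {k : ℕ} {P : (Fin k → locus p) → Prop} (h : IsInvariant P)
    {x y : Fin k → locus p} (hxy : Sim x y) : P x ↔ P y :=
  ⟨h x y hxy, h y x hxy.symm⟩

theorem RelDefinableRel.isInvariant {R : locus p → locus p → Prop} (hR : RelDefinableRel p A R)
    {k : ℕ} (i j : Fin k) : IsInvariant fun x : Fin k → locus p => R (x i) (x j) :=
  fun _ _ h => (h.rel hR i j).1

theorem IsInvariant.and {k : ℕ} {P Q : (Fin k → locus p) → Prop} (hP : IsInvariant P)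
    (hQ : IsInvariant Q) : IsInvariant fun x => P x ∧ Q x :=
  fun x y h => And.imp (hP x y h) (hQ x y h)

theorem IsInvariant.imp {k : ℕ} {P Q : (Fin k → locus p) → Prop} (hP : IsInvariant P)
    (hQ : IsInvariant Q) : IsInvariant fun x => P x → Q x :=
  fun x y h hx hy => hQ x y h (hx (hP y x h.symm hy))

/-- Homogeneity lets quantifiers range over `p(M)` itself. The bound variable takes index `0` and
shifts the free ones up, which accounts for the reversed indices in later applications. -/
theorem IsInvariant.exists {S : Type x} {sort : M → S} (hM : IsSaturated L sort) (hA : IsSmall A)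
    {k : ℕ} {P : (Fin (k + 1) → locus p) → Prop} (hP : IsInvariant P) :
    IsInvariant fun x : Fin k → locus p => ∃ c, P (Matrix.vecCons c x) := by
  rintro x y h ⟨c, hc⟩
  obtain ⟨d, hd⟩ := h.exists_cons hM hA c
  exact ⟨d, hP _ _ hd hc⟩

theorem IsInvariant.forall {S : Type x} {sort : M → S} (hM : IsSaturated L sort) (hA : IsSmall A)
    {k : ℕ} {P : (Fin (k + 1) → locus p) → Prop} (hP : IsInvariant P) :
    IsInvariant fun x : Fin k → locus p => ∀ c, P (Matrix.vecCons c x) := by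
  intro x y h hx d
  obtain ⟨c, hc⟩ := h.symm.exists_cons hM hA d
  exact hP _ _ hc.symm (hx c)

/-- An invariant binary relation whose fibers are relatively definable with arbitrary parameters
is relatively `A`-definable. -/
theorem IsInvariant.relDefinableRel {S : Type x} {sort : M → S} (hM : IsSaturated L sort)
    (hA : IsSmall A) {R : locus p → locus p → Prop}
    (hR : IsInvariant fun x : Fin 2 → locus p => R (x 1) (x 0))
    (hfib : ∀ a, RelDefinableSet p univ {x | R a x}) : RelDefinableRel p A R := by
  classical
  rcases isEmpty_or_nonempty (locus p) with he | ⟨⟨b⟩⟩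
  · exact ⟨∅, definable_empty, fun x => he.elim x⟩
  obtain ⟨D, hD, hRD⟩ := hfib b
  obtain ⟨C, -, hC⟩ := definable_iff_finitely_definable.1 hD
  have hRD : ∀ x : locus p, R b x ↔ x.1 ∈ D := hRD
  -- An index pairs a formula `Ψ(b, ·)`, on which two tuples must agree, with a member `P` of the
  -- type of `b`. A common point of all the `f i` would be two realizations of `p` with the same
  -- type over `A` and `b`, only one of them in the fiber `R b`.
  let I := {Ψ : Set (Fin n ⊕ Fin n → M) // A.Definable L Ψ} ×
    {P : Set (Fin n → M) // A.Definable L P ∧ b.1 ∈ P}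
  let B : Set M := A ∪ (C ∪ range b.1)
  have hB : IsSmall B := hA.union_finite (C.finite_toSet.union (finite_range b.1))
  have hDB : B.Definable L D :=
    hC.mono (subset_union_left.trans subset_union_right)
  have hfB : ∀ Ψ : Set (Fin n ⊕ Fin n → M), A.Definable L Ψ →
      B.Definable L {x : Fin n → M | Sum.elim b.1 x ∈ Ψ} := fun Ψ hΨ =>
    (definable_fiber hΨ b.1).mono (union_subset_union_right A subset_union_right)
  let l : (Fin n ⊕ Fin n → M) → Fin n → M := fun v => v ∘ Sum.inl
  let r : (Fin n ⊕ Fin n → M) → Fin n → M := fun v => v ∘ Sum.inr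
  have hl : ∀ {s : Set (Fin n → M)}, B.Definable L s → B.Definable L (l ⁻¹' s) :=
    fun hs => hs.preimage_comp _
  have hr : ∀ {s : Set (Fin n → M)}, B.Definable L s → B.Definable L (r ⁻¹' s) :=
    fun hs => hs.preimage_comp _
  let f : I → Set (Fin n ⊕ Fin n → M) := fun i =>
    l ⁻¹' (D ∩ i.2.1) ∩ r ⁻¹' (Dᶜ ∩ i.2.1) ∩
      ((l ⁻¹' {x | Sum.elim b.1 x ∈ i.1.1} ⇨ r ⁻¹' {x | Sum.elim b.1 x ∈ i.1.1}) ∩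
        (r ⁻¹' {x | Sum.elim b.1 x ∈ i.1.1} ⇨ l ⁻¹' {x | Sum.elim b.1 x ∈ i.1.1}))
  have hf : ∀ i, B.Definable L (f i) := fun i => by
    have h1 := hfB i.1.1 i.1.2
    have h2 : B.Definable L i.2.1 := i.2.2.1.mono subset_union_left
    exact ((hl (hDB.inter h2)).inter (hr (hDB.compl.inter h2))).inter
      (((hl h1).himp (hr h1)).inter ((hr h1).himp (hl h1)))
  have hmem : ∀ i v, v ∈ f i ↔ ((l v ∈ D ∧ l v ∈ i.2.1) ∧ (r v ∉ D ∧ r v ∈ i.2.1)) ∧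
      (Sum.elim b.1 (l v) ∈ i.1.1 ↔ Sum.elim b.1 (r v) ∈ i.1.1) := by
    intro i v
    simp only [f, himp_eq, mem_inter_iff, mem_preimage, mem_compl_iff, sup_eq_union, mem_union,
      mem_ofPred_eq]
    tauto
  let s : Fin n ⊕ Fin n → S := fun j => sort (Sum.elim b.1 b.1 j)
  have hbox : ∀ (x : locus p) (j : Fin n), sort (x.1 j) = sort (b.1 j) := fun x =>
    (sameType_of_mem_locus b x _ (hM.definable_box A fun j => sort (b.1 j))).1 fun _ => rfl
  obtain ⟨T, hT⟩ : ∃ T : Finset I, ¬ ∃ v, (∀ j, sort (v j) = s j) ∧ ∀ i ∈ T, v ∈ f i := by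
    by_contra! hc
    obtain ⟨v, -, hv⟩ := hM.exists_forall_mem hB s f hf hc
    have hv' := fun i => (hmem i v).1 (hv i)
    have hloc : ∀ z : Fin n → M,
        (∀ P : Set (Fin n → M), A.Definable L P → b.1 ∈ P → z ∈ P) → z ∈ locus p := fun z hz =>
      (mem_locus_congr (SameType.of_imp hz)).1 b.2
    have hlv : l v ∈ locus p := hloc _ fun P hP hbP =>
      (hv' (⟨∅, definable_empty⟩, ⟨P, hP, hbP⟩)).1.1.2
    have hrv : r v ∈ locus p := hloc _ fun P hP hbP =>
      (hv' (⟨∅, definable_empty⟩, ⟨P, hP, hbP⟩)).1.2.2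
    have hsim : Sim ![⟨l v, hlv⟩, b] ![⟨r v, hrv⟩, b] := by
      have h : SameType L A (Sum.elim b.1 (l v)) (Sum.elim b.1 (r v)) := fun Ψ hΨ =>
        (hv' (⟨Ψ, hΨ⟩, ⟨univ, definable_univ, mem_univ _⟩)).2
      have key : ∀ c : locus p, (fun q : Fin 2 × Fin n => (![c, b] q.1).1 q.2) =
          Sum.elim b.1 c.1 ∘ fun q => ![Sum.inr q.2, Sum.inl q.2] q.1 := by
        intro c
        ext ⟨i, t⟩
        fin_cases i <;> rfl
      rw [Sim, key, key]
      exact h.comp _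
    have h1 := (hv' (⟨∅, definable_empty⟩, ⟨univ, definable_univ, mem_univ _⟩)).1
    exact h1.2.1 ((hRD ⟨r v, hrv⟩).1 (hR _ _ hsim ((hRD ⟨l v, hlv⟩).2 h1.1.1)))
  -- By compactness, the finitely many formulas in `T` already decide `R b x`; hence `R b` is a
  -- finite union of truth patterns, each defined over `A` and `b`.
  let pat : locus p → Finset I := fun x => T.filter fun i => Sum.elim b.1 x.1 ∈ i.1.1
  have hpat : ∀ x x', pat x = pat x' → R b x → R b x' := by
    intro x x' hxx hx
    by_contra hx'
    refine hT ⟨Sum.elim x.1 x'.1, ?_, fun i hi => (hmem i _).2 ⟨⟨⟨(hRD x).1 hx, ?_⟩,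
      fun h => hx' ((hRD x').2 h), ?_⟩, ?_⟩⟩
    · rintro (j | j)
      · exact hbox x j
      · exact hbox x' j
    · exact (sameType_of_mem_locus b x _ i.2.2.1).1 i.2.2.2
    · exact (sameType_of_mem_locus b x' _ i.2.2.1).1 i.2.2.2
    · have := Finset.ext_iff.1 hxx i
      simp only [pat, Finset.mem_filter, hi, true_and] at this
      exact this
  let good : Finset (Finset I) := T.powerset.filter fun U => ∃ x, R b x ∧ pat x = U
  let g : Finset I → Set (Fin n ⊕ Fin n → M) := fun U =>
    (⋂ i ∈ U, i.1.1) ∩ ⋂ i ∈ T \ U, (i.1.1)ᶜ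
  have hg : ∀ U, A.Definable L (g U) := fun U =>
    (definable_biInter_finset (fun i : I => i.1.2) U).inter
      (definable_biInter_finset (fun i : I => i.1.2.compl) (T \ U))
  have hgpat : ∀ U ⊆ T, ∀ x : locus p, Sum.elim b.1 x.1 ∈ g U ↔ pat x = U := by
    intro U hU x
    simp only [g, pat, mem_inter_iff, mem_iInter, mem_compl_iff, Finset.mem_sdiff,
      Finset.ext_iff, Finset.mem_filter]
    constructor
    · rintro ⟨h1, h2⟩ i
      exact ⟨fun hi => by_contra fun hiU => h2 i ⟨hi.1, hiU⟩ hi.2, fun hi => ⟨hU hi, h1 i hi⟩⟩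
    · intro h
      exact ⟨fun i hi => ((h i).2 hi).2, fun i hi hx => hi.2 ((h i).1 ⟨hi.1, hx⟩)⟩
  have hfinal : ∀ x : locus p, R b x ↔ Sum.elim b.1 x.1 ∈ ⋃ U ∈ good, g U := by
    intro x
    rw [mem_iUnion₂]
    constructor
    · intro hx
      have hsub : pat x ⊆ T := Finset.filter_subset _ _
      exact ⟨pat x, Finset.mem_filter.2 ⟨Finset.mem_powerset.2 hsub, x, hx, rfl⟩,
        (hgpat _ hsub x).2 rfl⟩
    · rintro ⟨U, hU, hx⟩
      obtain ⟨hU, x', hx', rfl⟩ := Finset.mem_filter.1 hU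
      exact hpat x' x ((hgpat _ (Finset.mem_powerset.1 hU) x).1 hx).symm hx'
  have hdef : A.Definable L (⋃ U ∈ good, g U) := definable_biUnion_finset hg good
  refine ⟨_, hdef, fun a y => ?_⟩
  obtain ⟨x, hx⟩ := (sim_singleton a b).exists_cons hM hA y
  exact (hR.iff hx).trans ((hfinal x).trans
    (hx.symm.rel ⟨_, hdef, fun _ _ => Iff.rfl⟩ 1 0))

end Locus

section OrderLemmas

variable {X : Type*} {lt tri : X → X → Prop}

/-! ### Convex components -/

/-- The largest convex subset of `D` containing `x`, where `x ∈ D`. -/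
def componentOf (lt : X → X → Prop) (D : Set X) (x : X) : Set X :=
  ⋃₀ {C | C ⊆ D ∧ IsConvex lt C ∧ x ∈ C}

theorem isConvex_singleton [IsStrictTotalOrder X lt] (x : X) : IsConvex lt {x} := by
  rintro a b c rfl rfl h h'
  exact absurd h (asymm_of lt h')

theorem mem_componentOf [IsStrictTotalOrder X lt] {D : Set X} {x : X} (hx : x ∈ D) :
    x ∈ componentOf lt D x :=
  ⟨{x}, ⟨singleton_subset_iff.2 hx, isConvex_singleton x, rfl⟩, rfl⟩

theorem componentOf_mem_convexComponents [IsStrictTotalOrder X lt] {D : Set X} {x : X}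
    (hx : x ∈ D) : componentOf lt D x ∈ convexComponents lt D := by
  refine ⟨⟨sUnion_subset fun C hC => hC.1, ?_⟩, fun C hC hsub =>
    subset_sUnion_of_mem ⟨hC.1, hC.2, hsub (mem_componentOf hx)⟩⟩
  rintro a b c ⟨C, hC, ha⟩ ⟨C', hC', hb⟩ hac hcb
  rcases trichotomous_of lt c x with h | rfl | h
  · exact ⟨C, hC, hC.2.1 ha hC.2.2 hac h⟩
  · exact mem_componentOf hx
  · exact ⟨C', hC', hC'.2.1 hC'.2.2 hb h hcb⟩

/-- Iterating `x ↦ x'` inside `S` gives an increasing sequence in `D` with a point outside `D`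
between consecutive terms, so the terms lie in distinct components. -/
theorem convexComponents_infinite [IsStrictTotalOrder X lt] {D S : Set X} (hS : S.Nonempty)
    (hSD : S ⊆ D) (h : ∀ x ∈ S, ∃ x' ∈ S, ∃ g ∉ D, lt x g ∧ lt g x') :
    (convexComponents lt D).Infinite := by
  obtain ⟨x₀, h₀⟩ := hS
  choose! next hnext g hg hlt using h
  let f : ℕ → X := fun i => next^[i] x₀
  have hfS : ∀ i, f i ∈ S := by
    intro i
    induction i with
    | zero => exact h₀
    | succ i ih =>
      simp only [f, Function.iterate_succ_apply']
      exact hnext _ ih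
  have hf : ∀ i, lt (f i) (g (f i)) ∧ lt (g (f i)) (f (i + 1)) := by
    intro i
    simp only [f, Function.iterate_succ_apply']
    exact hlt _ (hfS i)
  have key : ∀ i j, i < j → lt (g (f i)) (f j) := by
    intro i j hij
    induction hij with
    | refl => exact (hf i).2
    | step _ ih => exact trans_of lt ih (trans_of lt (hf _).1 (hf _).2)
  have hne : ∀ i j, i < j → componentOf lt D (f i) ≠ componentOf lt D (f j) := by
    intro i j hij heq
    have hc := (componentOf_mem_convexComponents (lt := lt) (hSD (hfS i))).1
    refine hg _ (hfS i) (hc.1 (hc.2 (mem_componentOf (hSD (hfS i))) ?_ (hf i).1 (key i j hij)))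
    rw [heq]
    exact mem_componentOf (hSD (hfS j))
  refine infinite_of_injective_forall_mem (f := fun i => componentOf lt D (f i)) ?_ fun i =>
    componentOf_mem_convexComponents (hSD (hfS i))
  intro i j hij
  by_contra hc
  rcases lt_or_gt_of_ne hc with h | h
  · exact hne _ _ h hij
  · exact hne _ _ h hij.symm

theorem convexComponents_swap (D : Set X) :
    convexComponents (Function.swap lt) D = convexComponents lt D := by
  have : ∀ C, IsConvex (Function.swap lt) C ↔ IsConvex lt C := fun C =>
    ⟨fun h a b c ha hb hac hcb => h hb ha hcb hac, fun h a b c ha hb hac hcb => h hb ha hcb hac⟩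
  simp only [convexComponents, this]

theorem convexComponents_infinite' [IsStrictTotalOrder X lt] {D S : Set X} (hS : S.Nonempty)
    (hSD : S ⊆ D) (h : ∀ x ∈ S, ∃ x' ∈ S, ∃ g ∉ D, lt x' g ∧ lt g x) :
    (convexComponents lt D).Infinite := by
  rw [← convexComponents_swap]
  refine convexComponents_infinite hS hSD fun x hx => ?_
  obtain ⟨x', hx', g, hg, h1, h2⟩ := h x hx
  exact ⟨x', hx', g, hg, h2, h1⟩

/-- A set with finitely many convex components is eventually constant on every set `Z`. -/
theorem exists_eventually_mem_or_notMem [IsStrictTotalOrder X lt] {D Z : Set X}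
    (hD : (convexComponents lt D).Finite) (hZ : Z.Nonempty) :
    ∃ e ∈ Z, (∀ y ∈ Z, ¬ lt y e → y ∈ D) ∨ ∀ y ∈ Z, ¬ lt y e → y ∉ D := by
  by_contra! hc
  obtain ⟨z, hz⟩ := hZ
  have step : ∀ y ∈ Z, y ∉ D → ∃ x ∈ Z ∩ D, lt y x := by
    intro y hy hyD
    obtain ⟨x, hx, hxy, hxD⟩ := (hc y hy).2
    rcases trichotomous_of lt x y with h | rfl | h
    · exact absurd h hxy
    · exact absurd hxD hyD
    · exact ⟨x, ⟨hx, hxD⟩, h⟩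
  refine convexComponents_infinite (lt := lt) (S := Z ∩ D) ?_ inter_subset_right ?_ hD
  · obtain ⟨y, hy, -, hyD⟩ := (hc z hz).1
    obtain ⟨x, hx, -⟩ := step y hy hyD
    exact ⟨x, hx⟩
  · rintro x ⟨hx, hxD⟩
    obtain ⟨y, hy, hyx, hyD⟩ := (hc x hx).1
    obtain ⟨x', hx', hyx'⟩ := step y hy hyD
    rcases trichotomous_of lt y x with h | rfl | h
    · exact absurd h hyx
    · exact absurd hxD hyD
    · exact ⟨x', hx', y, hyD, h, hyx'⟩

/-! ### Agreement of two orders on the right of a point -/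

/-- The largest final part of `(X, lt)` on the right of `a` all of whose elements are above `a`
with respect to `tri`. -/
def rightAgreement (lt tri : X → X → Prop) (a : X) : Set X :=
  {x | lt a x ∧ ∀ y, ¬ lt y x → tri a y}

theorem lt_of_mem_rightAgreement {a x : X} (h : x ∈ rightAgreement lt tri a) : lt a x :=
  h.1

theorem tri_of_mem_rightAgreement [IsStrictTotalOrder X lt] {a x : X}
    (h : x ∈ rightAgreement lt tri a) : tri a x :=
  h.2 x (irrefl_of lt x)

theorem rightAgreement_of_not_lt [IsStrictTotalOrder X lt] {a x y : X}
    (h : x ∈ rightAgreement lt tri a) (hxy : ¬ lt y x) : y ∈ rightAgreement lt tri a := by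
  rcases trichotomous_of lt y x with h' | rfl | h'
  · exact absurd h' hxy
  · exact h
  · exact ⟨trans_of lt h.1 h', fun z hz => h.2 z fun hzx => hz (trans_of lt hzx h')⟩

theorem lt_of_mem_of_notMem_rightAgreement [IsStrictTotalOrder X lt] {a x y : X}
    (hx : x ∈ rightAgreement lt tri a) (hy : y ∉ rightAgreement lt tri a) : lt y x := by
  by_contra h
  exact hy (rightAgreement_of_not_lt hx h)

theorem notMem_rightAgreement_self [IsStrictTotalOrder X lt] (a : X) :
    a ∉ rightAgreement lt tri a :=
  fun h => irrefl_of lt a h.1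

/-- `{x | tri a x}` is eventually constant on the points right of `a` outside `F(a)`. Were the
constant value "true", the threshold `e` would itself belong to `F(a)`. -/
theorem exists_eventually_tri_left [IsStrictTotalOrder X lt] [IsStrictTotalOrder X tri] {a z : X}
    (hS : (convexComponents lt {x | tri a x}).Finite) (haz : lt a z)
    (hz : z ∉ rightAgreement lt tri a) :
    ∃ e, lt a e ∧ e ∉ rightAgreement lt tri a ∧
      ∀ y ∉ rightAgreement lt tri a, ¬ lt y e → tri y a := by
  obtain ⟨e, ⟨hae, he⟩, h | h⟩ := exists_eventually_mem_or_notMem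
    (Z := {y | lt a y ∧ y ∉ rightAgreement lt tri a}) hS ⟨z, haz, hz⟩
  · refine absurd ⟨hae, fun y hy => ?_⟩ he
    by_cases hya : y ∈ rightAgreement lt tri a
    · exact tri_of_mem_rightAgreement hya
    · refine h y ⟨?_, hya⟩ hy
      rcases trichotomous_of lt y e with h' | rfl | h'
      · exact absurd h' hy
      · exact hae
      · exact trans_of lt hae h'
  · refine ⟨e, hae, he, fun y hya hy => ?_⟩
    have hay : lt a y := by
      rcases trichotomous_of lt y e with h' | rfl | h'
      · exact absurd h' hy
      · exact hae
      · exact trans_of lt hae h'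
    rcases trichotomous_of tri y a with h' | rfl | h'
    · exact h'
    · exact absurd hay (irrefl_of lt y)
    · exact absurd h' (h y ⟨hay, hya⟩ hy)

theorem rightAgreement_subset [IsStrictTotalOrder X lt] [IsStrictTotalOrder X tri] {a y : X}
    (hy : y ∉ rightAgreement lt tri a) (hya : tri y a) :
    rightAgreement lt tri a ⊆ rightAgreement lt tri y := fun _ hw =>
  ⟨lt_of_mem_of_notMem_rightAgreement hw hy, fun v hv => trans_of tri hya (hw.2 v hv)⟩

/-- Between `y'` and `y` there is a point that agrees with the two orders at `y`, while `y'` does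
not, and the right agreement of `y'` is contained in that of `y`. -/
def NestedAgreement (lt tri : X → X → Prop) (y' y : X) : Prop :=
  (∃ u, lt y' u ∧ y ∈ rightAgreement lt tri u) ∧ y ∉ rightAgreement lt tri y' ∧
    ∀ z, z ∈ rightAgreement lt tri y' → z ∈ rightAgreement lt tri y

/-- Iteration from `c` moves left through points `y` with `F(y) ⊆ F(c)`, so `c ∉ F(y)`. Each
intermediate `u` has `c ∈ F(u)`, which separates components. -/
theorem not_forall_exists_nestedAgreement [IsStrictTotalOrder X lt] (c : X)
    (hF : (convexComponents lt {y | c ∉ rightAgreement lt tri y}).Finite) :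
    ¬ ∀ y, ∃ y', NestedAgreement lt tri y' y := by
  intro h
  have hc := notMem_rightAgreement_self (lt := lt) (tri := tri) c
  refine convexComponents_infinite' (lt := lt)
    (S := {y | ¬ lt c y ∧ rightAgreement lt tri y ⊆ rightAgreement lt tri c})
    ⟨c, irrefl_of lt c, Subset.rfl⟩ (fun y hy hcy => hc (hy.2 hcy)) ?_ hF
  rintro y ⟨hy, hyc⟩
  obtain ⟨y', ⟨u, hu, huy⟩, -, hsub⟩ := h y
  have huy' := lt_of_mem_rightAgreement huy
  refine ⟨y', ⟨fun hcy => hy (trans_of lt hcy (trans_of lt hu huy')),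
    Subset.trans hsub hyc⟩, u, ?_, hu, huy'⟩
  exact not_not.2 (rightAgreement_of_not_lt huy hy)

theorem rightAgreement_eq_of_notMem [IsStrictTotalOrder X lt] [IsStrictTotalOrder X tri]
    (hS : ∀ a, (convexComponents lt {x | tri a x}).Finite)
    (hN : ∀ y' y, ¬ NestedAgreement lt tri y' y) {a z : X} (haz : lt a z)
    (hz : z ∉ rightAgreement lt tri a) : rightAgreement lt tri a = rightAgreement lt tri z := by
  have hsub : ∀ {a z : X}, lt a z → z ∉ rightAgreement lt tri a →
      rightAgreement lt tri z ⊆ rightAgreement lt tri a := by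
    intro a z haz hz t ht
    by_contra hta
    obtain ⟨e, hae, he, hev⟩ := exists_eventually_tri_left (hS a) haz hz
    -- Here `y` is the larger of `e` and `t`: it lies in `F(z)` but not in `F(a)`, and `y ◁ a` gives
    -- `F(a) ⊆ F(y)`, a nested pair.
    obtain ⟨y, hya, hye, hyt⟩ : ∃ y ∉ rightAgreement lt tri a, ¬ lt y e ∧ ¬ lt y t := by
      by_cases h : lt t e
      · exact ⟨e, he, irrefl_of lt e, asymm_of lt h⟩
      · exact ⟨t, hta, h, irrefl_of lt t⟩
    exact hN a y ⟨⟨z, haz, rightAgreement_of_not_lt ht hyt⟩, hya,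
      rightAgreement_subset hya (hev y hya hye)⟩
  refine Subset.antisymm (fun t ht => ?_) (hsub haz hz)
  by_contra htz
  obtain ⟨e, hae, he, hev⟩ := exists_eventually_tri_left (hS a) haz hz
  -- Now `y` is the larger of `e` and `z`. Since `F(a) ⊆ F(y)`, only `F(y) ⊆ F(z)` is missing, and
  -- it follows from `hsub` when `z < y`.
  obtain ⟨y, hya, hye, hyz⟩ : ∃ y ∉ rightAgreement lt tri a, ¬ lt y e ∧ ¬ lt y z := by
    by_cases h : lt z e
    · exact ⟨e, he, irrefl_of lt e, asymm_of lt h⟩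
    · exact ⟨z, hz, h, irrefl_of lt z⟩
  have hty := rightAgreement_subset hya (hev y hya hye) ht
  rcases trichotomous_of lt y z with h | rfl | h
  · exact hyz h
  · exact htz hty
  · exact htz (hsub h (fun hy => htz (rightAgreement_of_not_lt hy
      (asymm_of lt (lt_of_mem_of_notMem_rightAgreement ht hya)))) hty)

/-! ### The last equivalence relation -/

/-- The equivalence relation whose classes consist of points with the same right agreement. -/
def lastEquiv (lt tri : X → X → Prop) : Setoid X :=
  Setoid.ker (rightAgreement lt tri)

/-- For `x < y`, membership in the right agreement of `x` means non-equivalence. -/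
def IsRegular (lt tri : X → X → Prop) : Prop :=
  ∀ x y, lt x y → (lastEquiv lt tri x y ↔ y ∉ rightAgreement lt tri x)

theorem isRegular_of_not_nestedAgreement [IsStrictTotalOrder X lt] [IsStrictTotalOrder X tri]
    (hS : ∀ a, (convexComponents lt {x | tri a x}).Finite)
    (hN : ∀ y' y, ¬ NestedAgreement lt tri y' y) : IsRegular lt tri := by
  refine fun x y hxy => ⟨fun h hy => ?_, rightAgreement_eq_of_notMem hS hN hxy⟩
  have h : rightAgreement lt tri x = rightAgreement lt tri y := h
  rw [h] at hy
  exact notMem_rightAgreement_self y hy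

theorem setoid_le_of_lt [IsStrictTotalOrder X lt] {E E' : Setoid X}
    (h : ∀ x y, lt x y → E x y → E' x y) : E ≤ E' := by
  intro x y hE
  rcases trichotomous_of lt x y with hxy | rfl | hxy
  · exact h x y hxy hE
  · exact E'.refl x
  · exact E'.symm (h y x hxy (E.symm hE))

theorem setoid_eq_of_lt [IsStrictTotalOrder X lt] {E E' : Setoid X}
    (h : ∀ x y, lt x y → (E x y ↔ E' x y)) : E = E' :=
  le_antisymm (setoid_le_of_lt fun x y hxy => (h x y hxy).1)
    (setoid_le_of_lt fun x y hxy => (h x y hxy).2)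

theorem exists_lt_of_not_le [IsStrictTotalOrder X lt] {E E' : Setoid X} (h : ¬ E ≤ E') :
    ∃ x y, lt x y ∧ E x y ∧ ¬ E' x y := by
  by_contra! hc
  exact h (setoid_le_of_lt hc)

theorem IsRegular.isConvexEquiv [IsStrictTotalOrder X lt] (h : IsRegular lt tri) :
    IsConvexEquiv lt (lastEquiv lt tri) := by
  intro d a b c ha hb hac hcb
  have hab : lastEquiv lt tri a b := (lastEquiv lt tri).trans ha ((lastEquiv lt tri).symm hb)
  have hb' := (h a b (trans_of lt hac hcb)).1 hab
  have hc : lastEquiv lt tri a c := (h a c hac).2 fun hc =>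
    hb' (rightAgreement_of_not_lt hc (asymm_of lt hcb))
  exact (lastEquiv lt tri).trans ((lastEquiv lt tri).symm hc) ha

theorem IsRegular.tri_of_lt [IsStrictTotalOrder X lt] (h : IsRegular lt tri) {x y : X}
    (hxy : lt x y) (hE : ¬ lastEquiv lt tri x y) : tri x y :=
  tri_of_mem_rightAgreement (not_not.1 (mt (h x y hxy).2 hE))

theorem IsRegular.tri_iff [IsStrictTotalOrder X lt] [IsStrictTotalOrder X tri]
    (h : IsRegular lt tri) (x y : X) (hE : ¬ lastEquiv lt tri x y) : tri x y ↔ lt x y := by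
  refine ⟨fun ht => ?_, fun hxy => h.tri_of_lt hxy hE⟩
  rcases trichotomous_of lt x y with hxy | rfl | hxy
  · exact hxy
  · exact absurd ht (irrefl_of tri x)
  · exact absurd ht (asymm_of tri (h.tri_of_lt hxy fun h => hE ((lastEquiv lt tri).symm h)))

/-! ### Reversing an order inside convex classes -/

theorem IsConvexEquiv.lt_of_rel_left [IsStrictTotalOrder X lt] {E : Setoid X}
    (hE : IsConvexEquiv lt E) {x y z : X} (hxy : E x y) (hyz : ¬ E y z) (h : lt y z) :
    lt x z := by
  rcases trichotomous_of lt x z with hxz | rfl | hxz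
  · exact hxz
  · exact absurd (E.symm hxy) hyz
  · exact absurd (E.symm (hE y (E.refl y) hxy h hxz)) hyz

theorem IsConvexEquiv.lt_of_rel_right [IsStrictTotalOrder X lt] {E : Setoid X}
    (hE : IsConvexEquiv lt E) {x y z : X} (hxy : ¬ E x y) (hyz : E y z) (h : lt x y) :
    lt x z := by
  rcases trichotomous_of lt x z with hxz | rfl | hxz
  · exact hxz
  · exact absurd (E.symm hyz) hxy
  · exact absurd (hE y (E.symm hyz) (E.refl y) hxz h) hxy

theorem ltE_of_rel {E : Setoid X} {x y : X} (h : E x y) : ltE tri E x y ↔ tri y x := by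
  simp [ltE, h]

theorem ltE_of_not_rel {E : Setoid X} {x y : X} (h : ¬ E x y) : ltE tri E x y ↔ tri x y := by
  simp [ltE, h]

theorem ltE_ltE (E : Setoid X) : ltE (ltE tri E) E = tri := by
  ext x y
  by_cases h : E x y
  · rw [ltE_of_rel h, ltE_of_rel (E.symm h)]
  · rw [ltE_of_not_rel h, ltE_of_not_rel h]

theorem ltE_bot : ltE lt ⊥ = lt := by
  ext x y
  by_cases h : x = y
  · subst h
    exact ltE_of_rel rfl
  · exact ltE_of_not_rel h

theorem isStrictTotalOrder_ltE [IsStrictTotalOrder X lt] [IsStrictTotalOrder X tri] {E : Setoid X}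
    (hE : IsConvexEquiv lt E) (h : ∀ x y, ¬ E x y → (tri x y ↔ lt x y)) :
    IsStrictTotalOrder X (ltE tri E) where
  irrefl x hx := irrefl_of tri x ((ltE_of_rel (E.refl x)).1 hx)
  trichotomous x y hxy hyx := by
    by_cases hE : E x y
    · rw [ltE_of_rel hE] at hxy
      rw [ltE_of_rel (E.symm hE)] at hyx
      exact Std.Trichotomous.trichotomous (r := tri) x y hyx hxy
    · rw [ltE_of_not_rel hE] at hxy
      rw [ltE_of_not_rel fun h => hE (E.symm h)] at hyx
      exact Std.Trichotomous.trichotomous (r := tri) x y hxy hyx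
  trans x y z hxy hyz := by
    by_cases h1 : E x y <;> by_cases h2 : E y z
    · rw [ltE_of_rel h1] at hxy
      rw [ltE_of_rel h2] at hyz
      exact (ltE_of_rel (E.trans h1 h2)).2 (trans_of tri hyz hxy)
    · have h3 : ¬ E x z := fun h3 => h2 (E.trans (E.symm h1) h3)
      rw [ltE_of_not_rel h2, h _ _ h2] at hyz
      rw [ltE_of_not_rel h3, h _ _ h3]
      exact hE.lt_of_rel_left h1 h2 hyz
    · have h3 : ¬ E x z := fun h3 => h1 (E.trans h3 (E.symm h2))
      rw [ltE_of_not_rel h1, h _ _ h1] at hxy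
      rw [ltE_of_not_rel h3, h _ _ h3]
      exact hE.lt_of_rel_right h1 h2 hxy
    · rw [ltE_of_not_rel h1, h _ _ h1] at hxy
      rw [ltE_of_not_rel h2, h _ _ h2] at hyz
      have h3 : ¬ E x z := fun h3 => h1 (E.symm (hE x (E.refl x) (E.symm h3) hxy hyz))
      rw [ltE_of_not_rel h3, h _ _ h3]
      exact trans_of lt hxy hyz

/-- Outside the old class nothing changes, so agreement there persists and the relation cannot grow.
Far to the right inside the class of `x`, the order `tri` was opposite to `lt`; after reversal these
points agree, so the class shrinks. -/
theorem lastEquiv_ltE_lt [IsStrictTotalOrder X lt] [IsStrictTotalOrder X tri]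
    (hS : ∀ a, (convexComponents lt {x | tri a x}).Finite) (h : IsRegular lt tri)
    (h' : IsRegular lt (ltE tri (lastEquiv lt tri))) (hne : lastEquiv lt tri ≠ ⊥) :
    lastEquiv lt (ltE tri (lastEquiv lt tri)) < lastEquiv lt tri := by
  set E := lastEquiv lt tri with hEdef
  have hconv : IsConvexEquiv lt E := h.isConvexEquiv
  refine lt_of_le_of_ne (setoid_le_of_lt (lt := lt) fun x y hxy hE' => ?_) fun heq => ?_
  · by_contra hE
    refine (h' x y hxy).1 hE' ⟨hxy, fun z hz => ?_⟩
    have hF : z ∈ rightAgreement lt tri x :=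
      rightAgreement_of_not_lt (not_not.1 (mt (h x y hxy).2 hE)) hz
    have hxz := lt_of_mem_rightAgreement hF
    rw [ltE_of_not_rel fun hEz => (h x z hxz).1 hEz hF]
    exact tri_of_mem_rightAgreement hF
  · obtain ⟨x, y, hxy, hE, -⟩ := exists_lt_of_not_le (lt := lt) (mt le_bot_iff.1 hne)
    obtain ⟨e, hxe, he, hev⟩ := exists_eventually_tri_left (hS x) hxy ((h x y hxy).1 hE)
    have hEe : E x e := (h x e hxe).2 he
    rw [← heq] at hEe
    refine (h' x e hxe).1 hEe ⟨hxe, fun z hz => ?_⟩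
    have hxz : lt x z := by
      rcases trichotomous_of lt z e with h' | rfl | h'
      · exact absurd h' hz
      · exact hxe
      · exact trans_of lt hxe h'
    by_cases hzF : z ∈ rightAgreement lt tri x
    · rw [ltE_of_not_rel fun hEz => (h x z hxz).1 hEz hzF]
      exact tri_of_mem_rightAgreement hzF
    · rw [ltE_of_rel ((h x z hxz).2 hzF)]
      exact hev z hzF hz

theorem eq_of_lastEquiv_eq_bot [IsStrictTotalOrder X lt] [IsStrictTotalOrder X tri]
    (h : IsRegular lt tri) (hE : lastEquiv lt tri = ⊥) : tri = lt := by
  ext x y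
  by_cases hxy : x = y
  · subst hxy
    exact iff_of_false (irrefl_of tri x) (irrefl_of lt x)
  · exact h.tri_iff x y (by rw [hE]; exact hxy)

/-- An infinite descent of last equivalence relations, witnessed by points `x i`, produces
infinitely many convex components. -/
theorem convexComponents_infinite_of_descent [IsStrictTotalOrder X lt]
    {T : ℕ → X → X → Prop} {E : ℕ → Setoid X} (hT : ∀ i, IsStrictTotalOrder X (T i))
    (hstep : ∀ i, T (i + 1) = ltE (T i) (E i)) (hE : ∀ i, IsConvexEquiv lt (E i))
    (hagree : ∀ i x y, ¬ E i x y → (T i x y ↔ lt x y)) (hanti : Antitone E) (a : X)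
    (f : ℕ → X) (hf : ∀ i, lt a (f i) ∧ E i a (f i) ∧ ¬ E (i + 1) a (f i)) :
    (convexComponents lt {x | T 0 a x}).Infinite := by
  have hdesc : ∀ i, lt (f (i + 1)) (f i) := by
    intro i
    rcases trichotomous_of lt (f (i + 1)) (f i) with h | h | h
    · exact h
    · exact absurd (h ▸ (hf (i + 1)).2.1) (hf i).2.2
    · exact absurd ((E (i + 1)).symm (hE (i + 1) a ((E (i + 1)).refl a)
        ((E (i + 1)).symm (hf (i + 1)).2.1) (hf i).1 h)) (hf i).2.2
  have hflip : ∀ i j, E i a (f j) → (T i a (f j) ↔ ¬ T (i + 1) a (f j)) := by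
    intro i j h
    have := hT i
    rw [hstep, ltE_of_rel h]
    refine ⟨asymm_of (T i), fun h' => ?_⟩
    rcases trichotomous_of (T i) a (f j) with h1 | h1 | h1
    · exact h1
    · exact absurd (hf j).1 (h1 ▸ irrefl_of lt a)
    · exact absurd h1 h'
  -- The point `f (i + d)` is affected by exactly the reversals `i, …, i + d`, after which the order
  -- agrees with `lt`. These are `d + 1` reversals, so `T i` is correct when `d` is odd.
  have hodd : ∀ d i, T i a (f (i + d)) ↔ Odd d := by
    intro d
    induction d with
    | zero =>
      intro i
      rw [Nat.add_zero, hflip i _ (hf i).2.1]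
      refine iff_of_false (not_not.2 ?_) (by decide)
      exact (hagree (i + 1) _ _ (hf i).2.2).2 (hf i).1
    | succ d ih =>
      intro i
      rw [hflip i _ (hanti (Nat.le_add_right i (d + 1)) (hf (i + (d + 1))).2.1),
        Nat.odd_add_one, ← ih (i + 1), show i + (d + 1) = i + 1 + d by omega]
  have hodd0 : ∀ d, f d ∈ {x | T 0 a x} ↔ Odd d := fun d => by
    have := hodd d 0
    rwa [Nat.zero_add] at this
  refine convexComponents_infinite' (lt := lt) (S := {x | ∃ d, Odd d ∧ f d = x})
    ⟨f 1, 1, odd_one, rfl⟩ ?_ ?_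
  · rintro _ ⟨d, hd, rfl⟩
    exact (hodd0 d).2 hd
  · rintro _ ⟨d, hd, rfl⟩
    refine ⟨f (d + 2), ⟨d + 2, by simpa [Nat.odd_add] using hd, rfl⟩, f (d + 1), ?_,
      hdesc (d + 1), hdesc d⟩
    rw [hodd0, Nat.odd_add_one]
    exact not_not.2 hd

/-! ### Sequences of equivalence relations -/

theorem ltSeq_of_forall_not_rel {Es : List (Setoid X)} {x y : X} (h : ∀ E ∈ Es, ¬ E x y) :
    ltSeq lt Es x y ↔ lt x y := by
  induction Es using List.reverseRecOn with
  | nil => rfl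
  | append_singleton Es E ih =>
    rw [ltSeq, List.foldl_append]
    exact (ltE_of_not_rel (h E (by simp))).trans (ih fun E hE => h E (by simp [hE]))

theorem ltSeq_ofFn_succ {m : ℕ} (E : Fin (m + 1) → Setoid X) :
    ltSeq lt (List.ofFn E) = ltE (ltSeq lt (List.ofFn (Fin.init E))) (E (Fin.last m)) := by
  rw [List.ofFn_succ', List.concat_eq_append, ltSeq, List.foldl_append]
  rfl

/-- The right agreement of `lt` and `ltSeq lt E` consists of the points that are not equivalent
with respect to the last member of `E`. -/
theorem mem_rightAgreement_ltSeq_iff [IsStrictTotalOrder X lt] {m : ℕ}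
    {E : Fin (m + 1) → Setoid X} (hmono : StrictMono E) (hzero : E 0 = ⊥)
    (hconv : ∀ i, IsConvexEquiv lt (E i))
    (hex : ∀ i j, i < j → ∀ a, ∃ b, lt a b ∧ E j a b ∧ ¬ E i a b) {x y : X} (hxy : lt x y) :
    y ∈ rightAgreement lt (ltSeq lt (List.ofFn E)) x ↔ ¬ E (Fin.last m) x y := by
  constructor
  · intro hy hE
    obtain _ | m := m
    · have h0 : Fin.last 0 = 0 := rfl
      rw [h0, hzero] at hE
      have hE : x = y := hE
      exact irrefl_of lt y (hE ▸ hxy)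
    -- A point `z` not left of `y`, in the last class of `x` but outside the previous one, is
    -- affected by the last reversal only, so it disagrees with `lt`.
    obtain ⟨z, hxz, hyz, hEz, hEz'⟩ : ∃ z, lt x z ∧ ¬ lt z y ∧ E (Fin.last (m + 1)) x z ∧
        ¬ E (Fin.last m).castSucc x z := by
      obtain ⟨z, hxz, hEz, hEz'⟩ := hex _ _ (Fin.castSucc_lt_last (Fin.last m)) x
      by_cases hzy : lt z y
      · refine ⟨y, hxy, irrefl_of lt y, hE, fun h => hEz' ?_⟩
        exact (E _).symm (hconv _ x ((E _).refl x) ((E _).symm h) hxz hzy)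
      · exact ⟨z, hxz, hzy, hEz, hEz'⟩
    have htri := hy.2 z hyz
    rw [ltSeq_ofFn_succ, ltE_of_rel hEz, ltSeq_of_forall_not_rel] at htri
    · exact asymm_of lt htri hxz
    · intro E' hE'
      obtain ⟨i, rfl⟩ := (List.mem_ofFn' _ _).1 hE'
      exact fun h => hEz' ((E _).symm
        (hmono.monotone (Fin.castSucc_le_castSucc_iff.2 (Fin.le_last i)) h))
  · intro hE
    refine ⟨hxy, fun z hz => ?_⟩
    have hxz : lt x z := by
      rcases trichotomous_of lt z y with h' | rfl | h'
      · exact absurd h' hz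
      · exact hxy
      · exact trans_of lt hxy h'
    rw [ltSeq_of_forall_not_rel]
    · exact hxz
    · intro E' hE' h
      obtain ⟨i, rfl⟩ := (List.mem_ofFn' _ _).1 hE'
      have h := hmono.monotone (Fin.le_last i) h
      rcases trichotomous_of lt z y with h' | rfl | h'
      · exact hz h'
      · exact hE h
      · exact hE ((E _).symm (hconv _ x ((E _).refl x) ((E _).symm h) hxy h'))

end OrderLemmas

/-! ### Weakly o-minimal pairs: definability, existence, uniqueness, orientation -/

section Main

variable {L : FirstOrder.Language.{u, v}} {M : Type w} [L.Structure M] {A : Set M} {n : ℕ}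
  {p : TypeSpace L A n} {S : Type x} {sort : M → S} {lt tri : locus p → locus p → Prop}

theorem IsInvariant.of_point {P : locus p → Prop}
    (hP : IsInvariant fun x : Fin 1 → locus p => P (x 0)) {a : locus p} (h : P a) (b : locus p) :
    P b :=
  hP _ _ (sim_singleton a b) h

theorem isInvariant_mem_rightAgreement (hM : IsSaturated L sort) (hA : IsSmall A)
    (hlt : RelDefinableRel p A lt) (htri : RelDefinableRel p A tri) :
    IsInvariant fun x : Fin 2 → locus p => x 0 ∈ rightAgreement lt tri (x 1) :=
  (hlt.isInvariant 1 0).and (IsInvariant.forall hM hA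
    (P := fun z : Fin 3 → locus p => ¬ lt (z 0) (z 1) → tri (z 2) (z 0))
    ((hlt.compl.isInvariant 0 1).imp (htri.isInvariant 2 0)))

/-- Each fiber is either `{x | lt a x}` or, by eventual disagreement, `{x | lt e x} ∩ {x | tri a
x}`. The extra parameter `e` is removed by invariance. -/
theorem relDefinableRel_rightAgreement (hM : IsSaturated L sort) (hA : IsSmall A)
    (hlt : IsWeaklyOMinimalPair p lt) (htri : IsRelDefinableLinearOrder p tri) :
    RelDefinableRel p A fun a x => x ∈ rightAgreement lt tri a := by
  have := hlt.linearOrder.isStrictTotalOrder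
  have := htri.isStrictTotalOrder
  have hltd := hlt.linearOrder.relDefinable
  have htrid := htri.relDefinable
  refine IsInvariant.relDefinableRel hM hA (isInvariant_mem_rightAgreement hM hA hltd htrid)
    fun a => ?_
  by_cases hz : ∃ z, lt a z ∧ z ∉ rightAgreement lt tri a
  · obtain ⟨z, haz, hz⟩ := hz
    obtain ⟨e, hae, he, hev⟩ := exists_eventually_tri_left
      (hlt.finite_components _ (htrid.setOf_right a)) haz hz
    have heq : {x | x ∈ rightAgreement lt tri a} = {x | lt e x} ∩ {x | tri a x} := by
      refine Subset.antisymm (fun x hx =>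
        ⟨lt_of_mem_of_notMem_rightAgreement hx he, tri_of_mem_rightAgreement hx⟩) ?_
      rintro x ⟨hex, hax⟩
      by_contra hx
      exact asymm_of tri hax (hev x hx (asymm_of lt hex))
    rw [heq]
    exact (hltd.setOf_right e).inter (htrid.setOf_right a)
  · have heq : {x | x ∈ rightAgreement lt tri a} = {x | lt a x} :=
      Subset.antisymm (fun x hx => hx.1) fun x hx => by_contra fun h => hz ⟨x, hx, h⟩
    rw [heq]
    exact hltd.setOf_right a

theorem not_nestedAgreement (hM : IsSaturated L sort) (hA : IsSmall A)
    (hlt : IsWeaklyOMinimalPair p lt) (htri : IsRelDefinableLinearOrder p tri)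
    (y' y : locus p) : ¬ NestedAgreement lt tri y' y := by
  have := hlt.linearOrder.isStrictTotalOrder
  have hltd := hlt.linearOrder.relDefinable
  have hF := relDefinableRel_rightAgreement hM hA hlt htri
  intro h
  refine not_forall_exists_nestedAgreement (lt := lt) (tri := tri) y
    (hlt.finite_components _ (hF.compl.setOf_left y)) ?_
  refine IsInvariant.of_point (P := fun y => ∃ y', NestedAgreement lt tri y' y) ?_ ⟨y', h⟩
  refine IsInvariant.exists hM hA
    (P := fun z : Fin 2 → locus p => NestedAgreement lt tri (z 0) (z 1)) ?_
  refine IsInvariant.and ?_ ((hF.compl.isInvariant 0 1).and ?_)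
  · exact IsInvariant.exists hM hA
      (P := fun z : Fin 3 → locus p => lt (z 1) (z 0) ∧ z 2 ∈ rightAgreement lt tri (z 0))
      ((hltd.isInvariant 1 0).and (hF.isInvariant 0 2))
  · exact IsInvariant.forall hM hA
      (P := fun z : Fin 3 → locus p =>
        z 0 ∈ rightAgreement lt tri (z 1) → z 0 ∈ rightAgreement lt tri (z 2))
      ((hF.isInvariant 1 0).imp (hF.isInvariant 2 0))

theorem isRegular_of_isWeaklyOMinimalPair (hM : IsSaturated L sort) (hA : IsSmall A)
    (hlt : IsWeaklyOMinimalPair p lt) (htri : IsRelDefinableLinearOrder p tri) :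
    IsRegular lt tri :=
  have := hlt.linearOrder.isStrictTotalOrder
  have := htri.isStrictTotalOrder
  isRegular_of_not_nestedAgreement
    (fun a => hlt.finite_components _ (htri.relDefinable.setOf_right a))
    (not_nestedAgreement hM hA hlt htri)

/-- Regularity replaces equality of the sets `F(x)` and `F(y)` by the definable condition that
neither point lies in the right agreement of the other. -/
theorem lastEquiv_mem_relDefinableEquivs (hM : IsSaturated L sort) (hA : IsSmall A)
    (hlt : IsWeaklyOMinimalPair p lt) (htri : IsRelDefinableLinearOrder p tri) :
    lastEquiv lt tri ∈ relDefinableEquivs p := by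
  have := hlt.linearOrder.isStrictTotalOrder
  have hltd := hlt.linearOrder.relDefinable
  have hreg := isRegular_of_isWeaklyOMinimalPair hM hA hlt htri
  have hF := relDefinableRel_rightAgreement hM hA hlt htri
  obtain ⟨D, hD, h⟩ := (hltd.compl.or hF.compl).and (hltd.compl.or hF.compl).swap
  refine ⟨D, hD, fun x y => Iff.trans ?_ (h x y)⟩
  beta_reduce
  rcases trichotomous_of lt x y with hxy | rfl | hxy
  · rw [hreg x y hxy]
    simp [hxy, asymm_of lt hxy]
  · simp [irrefl_of lt x]
  · rw [(lastEquiv lt tri).comm', hreg y x hxy]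
    simp [hxy, asymm_of lt hxy]

theorem IsRelDefinableLinearOrder.ltE_lastEquiv (hM : IsSaturated L sort) (hA : IsSmall A)
    (hlt : IsWeaklyOMinimalPair p lt) (htri : IsRelDefinableLinearOrder p tri) :
    IsRelDefinableLinearOrder p (ltE tri (lastEquiv lt tri)) := by
  have := hlt.linearOrder.isStrictTotalOrder
  have := htri.isStrictTotalOrder
  have hreg := isRegular_of_isWeaklyOMinimalPair hM hA hlt htri
  have hE : RelDefinableRel p A _ := lastEquiv_mem_relDefinableEquivs hM hA hlt htri
  exact ⟨isStrictTotalOrder_ltE hreg.isConvexEquiv hreg.tri_iff,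
    (hE.and htri.relDefinable.swap).or (hE.compl.and htri.relDefinable)⟩

/-- Relatively `A`-definable equivalence relations are convex. -/
theorem isConvexEquiv_of_mem_relDefinableEquivs (hM : IsSaturated L sort) (hA : IsSmall A)
    (hlt : IsWeaklyOMinimalPair p lt) {E : Setoid (locus p)} (hE : E ∈ relDefinableEquivs p) :
    IsConvexEquiv lt E := by
  have := hlt.linearOrder.isStrictTotalOrder
  have hltd := hlt.linearOrder.relDefinable
  have hE : RelDefinableRel p A fun x y => E x y := hE
  by_contra hc
  simp only [IsConvexEquiv, IsConvex, not_forall] at hc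
  obtain ⟨d, a, b, c, ha, hb, hac, hcb, hc⟩ := hc
  have hstep : ∀ y, ∃ x, E x y ∧ ∃ g, ¬ E g y ∧ lt y g ∧ lt g x := by
    refine IsInvariant.of_point (a := a) ?_
      ⟨b, E.trans hb (E.symm ha), c, fun h => hc (E.trans h ha), hac, hcb⟩
    refine IsInvariant.exists hM hA (P := fun z : Fin 2 → locus p =>
      E (z 0) (z 1) ∧ ∃ g, ¬ E g (z 1) ∧ lt (z 1) g ∧ lt g (z 0)) ?_
    refine (hE.isInvariant 0 1).and (IsInvariant.exists hM hA (P := fun z : Fin 3 → locus p =>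
      ¬ E (z 0) (z 2) ∧ lt (z 2) (z 0) ∧ lt (z 0) (z 1)) ?_)
    exact (hE.compl.isInvariant 0 2).and ((hltd.isInvariant 2 0).and (hltd.isInvariant 0 1))
  refine convexComponents_infinite (lt := lt) (D := {x | E x d}) ⟨a, ha⟩ Subset.rfl ?_
    (hlt.finite_components _ (hE.setOf_left d))
  intro y hy
  obtain ⟨x, hx, g, hg, h1, h2⟩ := hstep y
  exact ⟨x, E.trans hx hy, g, fun h => hg (E.trans h (E.symm hy)), h1, h2⟩

/-- By symmetry a witnessing pair can be ordered with its second point on the right; homogeneity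
then moves its first point to `a`. -/
theorem exists_gt_of_lt (hM : IsSaturated L sort) (hA : IsSmall A)
    (hlt : IsWeaklyOMinimalPair p lt) {E E' : Setoid (locus p)} (hE : E ∈ relDefinableEquivs p)
    (hE' : E' ∈ relDefinableEquivs p) (h : E < E') (a : locus p) :
    ∃ b, lt a b ∧ E' a b ∧ ¬ E a b := by
  have := hlt.linearOrder.isStrictTotalOrder
  have hltd := hlt.linearOrder.relDefinable
  have hE : RelDefinableRel p A fun x y => E x y := hE
  have hE' : RelDefinableRel p A fun x y => E' x y := hE'
  obtain ⟨x, y, hxy⟩ := exists_lt_of_not_le (lt := lt) (not_le_of_gt h)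
  refine IsInvariant.of_point (P := fun a => ∃ b, lt a b ∧ E' a b ∧ ¬ E a b) ?_ ⟨y, hxy⟩ a
  exact IsInvariant.exists hM hA
    (P := fun z : Fin 2 → locus p => lt (z 1) (z 0) ∧ E' (z 1) (z 0) ∧ ¬ E (z 1) (z 0))
    ((hltd.isInvariant 1 0).and ((hE'.isInvariant 1 0).and (hE.compl.isInvariant 1 0)))

theorem bot_mem_relDefinableEquivs (hlt : IsWeaklyOMinimalPair p lt) :
    (⊥ : Setoid (locus p)) ∈ relDefinableEquivs p := by
  have := hlt.linearOrder.isStrictTotalOrder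
  have hltd := hlt.linearOrder.relDefinable
  obtain ⟨D, hD, h⟩ := hltd.compl.and hltd.compl.swap
  refine ⟨D, hD, fun x y => Iff.trans ?_ (h x y)⟩
  rw [Setoid.bot_def]
  refine ⟨fun h => ?_, fun h => Std.Trichotomous.trichotomous (r := lt) x y h.1 h.2⟩
  subst h
  exact ⟨irrefl_of lt x, irrefl_of lt x⟩

theorem Represents.isConvexEquiv (hM : IsSaturated L sort) (hA : IsSmall A)
    (hlt : IsWeaklyOMinimalPair p lt) {m : ℕ} {E : Fin (m + 1) → Setoid (locus p)}
    (h : Represents p lt tri E) (i : Fin (m + 1)) : IsConvexEquiv lt (E i) :=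
  isConvexEquiv_of_mem_relDefinableEquivs hM hA hlt (h.mem i)

/-- The last member of a representing sequence is determined by the two orders. -/
theorem Represents.last_eq (hM : IsSaturated L sort) (hA : IsSmall A)
    (hlt : IsWeaklyOMinimalPair p lt) (htri : IsRelDefinableLinearOrder p tri) {m : ℕ}
    {E : Fin (m + 1) → Setoid (locus p)} (h : Represents p lt tri E) :
    E (Fin.last m) = lastEquiv lt tri := by
  have := hlt.linearOrder.isStrictTotalOrder
  refine setoid_eq_of_lt (lt := lt) fun x y hxy => ?_
  have key := mem_rightAgreement_ltSeq_iff h.strictMono h.zero (h.isConvexEquiv hM hA hlt)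
    (fun i j hij => exists_gt_of_lt hM hA hlt (h.mem i) (h.mem j) (h.strictMono hij)) hxy
  rw [← h.eq_ltSeq] at key
  rw [isRegular_of_isWeaklyOMinimalPair hM hA hlt htri x y hxy, key, not_not]

theorem Represents.init {m : ℕ} {E : Fin (m + 2) → Setoid (locus p)}
    (h : Represents p lt tri E) :
    Represents p lt (ltE tri (E (Fin.last (m + 1)))) (Fin.init E) where
  strictMono i j hij := h.strictMono (Fin.castSucc_lt_castSucc_iff.2 hij)
  mem i := h.mem i.castSucc
  zero := h.zero
  eq_ltSeq := by
    nth_rewrite 1 [h.eq_ltSeq]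
    rw [ltSeq_ofFn_succ, ltE_ltE]

theorem Represents.snoc {m : ℕ} {E : Fin (m + 1) → Setoid (locus p)} {E' : Setoid (locus p)}
    (h : Represents p lt (ltE tri E') E) (hE' : E' ∈ relDefinableEquivs p)
    (hlast : E (Fin.last m) < E') :
    Represents p lt tri (Fin.snoc E E' : Fin (m + 2) → Setoid (locus p)) where
  strictMono := by
    refine Fin.strictMono_iff_lt_succ.2 fun i => ?_
    refine Fin.lastCases ?_ (fun i => ?_) i
    · rw [Fin.succ_last, Fin.snoc_last, Fin.snoc_castSucc]
      exact hlast
    · rw [Fin.succ_castSucc, Fin.snoc_castSucc, Fin.snoc_castSucc]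
      exact h.strictMono (Fin.castSucc_lt_succ)
  mem i := by
    refine Fin.lastCases ?_ (fun i => ?_) i
    · rw [Fin.snoc_last]
      exact hE'
    · rw [Fin.snoc_castSucc]
      exact h.mem i
  zero := by
    rw [← Fin.castSucc_zero, Fin.snoc_castSucc]
    exact h.zero
  eq_ltSeq := by
    rw [ltSeq_ofFn_succ, Fin.init_snoc, Fin.snoc_last, ← h.eq_ltSeq, ltE_ltE]

theorem represents_bot (hlt : IsWeaklyOMinimalPair p lt) :
    Represents p lt lt (fun _ : Fin 1 => (⊥ : Setoid (locus p))) where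
  strictMono i j hij := by omega
  mem _ := bot_mem_relDefinableEquivs hlt
  zero := rfl
  eq_ltSeq := ltE_bot.symm

/-- Both sequences end in `lastEquiv lt tri`, and their truncations represent the same reversed
order. Lengths cannot differ at the base, since a longer strictly increasing sequence starting at
`⊥` does not end at `⊥`. -/
theorem Represents.unique (hM : IsSaturated L sort) (hA : IsSmall A)
    (hlt : IsWeaklyOMinimalPair p lt) : ∀ {m m' : ℕ} {tri : locus p → locus p → Prop}
    (_ : IsRelDefinableLinearOrder p tri) {E : Fin (m + 1) → Setoid (locus p)}
    {E' : Fin (m' + 1) → Setoid (locus p)} (_ : Represents p lt tri E)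
    (_ : Represents p lt tri E'),
    (⟨m, E⟩ : (m : ℕ) × (Fin (m + 1) → Setoid (locus p))) = ⟨m', E'⟩ := by
  intro m
  induction m with
  | zero =>
    intro m' tri htri E E' h h'
    have hlast := (h.last_eq hM hA hlt htri).trans (h'.last_eq hM hA hlt htri).symm
    obtain _ | m' := m'
    · congr 1
      ext1 i
      rw [show i = 0 from Fin.fin_one_eq_zero i, h.zero, h'.zero]
    · have hlt' := h'.strictMono (Fin.last_pos (n := m'))
      rw [← hlast, h'.zero, ← h.zero] at hlt'
      exact absurd hlt' (lt_irrefl _)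
  | succ m ih =>
    intro m' tri htri E E' h h'
    have hE := h.last_eq hM hA hlt htri
    have hE' := h'.last_eq hM hA hlt htri
    obtain _ | m' := m'
    · have hlt' := h.strictMono (Fin.last_pos (n := m))
      rw [hE, ← hE', h.zero, ← h'.zero] at hlt'
      exact absurd hlt' (lt_irrefl _)
    · have hi := h.init
      have hi' := h'.init
      rw [hE] at hi
      rw [hE'] at hi'
      have heq := ih (IsRelDefinableLinearOrder.ltE_lastEquiv hM hA hlt htri) hi hi'
      obtain ⟨rfl, heq⟩ := Sigma.mk.inj heq
      congr 1
      rw [← Fin.snoc_init_self E, ← Fin.snoc_init_self E', eq_of_heq heq, hE, hE']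

/-- Iterating the reversal of the last equivalence relation ends at the order `lt`. -/
theorem exists_lastEquiv_iterate_eq_bot (hM : IsSaturated L sort) (hA : IsSmall A)
    (hlt : IsWeaklyOMinimalPair p lt) (htri : IsRelDefinableLinearOrder p tri) :
    ∃ i : ℕ, lastEquiv lt ((fun t => ltE t (lastEquiv lt t))^[i] tri) = ⊥ := by
  by_contra! hne
  have := hlt.linearOrder.isStrictTotalOrder
  let T : ℕ → locus p → locus p → Prop := fun i => (fun t => ltE t (lastEquiv lt t))^[i] tri
  have hstep : ∀ i, T (i + 1) = ltE (T i) (lastEquiv lt (T i)) := fun i =>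
    Function.iterate_succ_apply' _ _ _
  have hT : ∀ i, IsRelDefinableLinearOrder p (T i) := by
    intro i
    induction i with
    | zero => exact htri
    | succ i ih =>
      rw [hstep]
      exact IsRelDefinableLinearOrder.ltE_lastEquiv hM hA hlt ih
  have hSTO := fun i => (hT i).isStrictTotalOrder
  have hreg := fun i => isRegular_of_isWeaklyOMinimalPair hM hA hlt (hT i)
  have hdesc : ∀ i, lastEquiv lt (T (i + 1)) < lastEquiv lt (T i) := by
    intro i
    have := hSTO i
    have h := hreg (i + 1)
    rw [hstep] at h ⊢
    exact lastEquiv_ltE_lt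
      (fun a => hlt.finite_components _ ((hT i).relDefinable.setOf_right a)) (hreg i) h (hne i)
  have hmem := fun i => lastEquiv_mem_relDefinableEquivs hM hA hlt (hT i)
  obtain ⟨a, -, -⟩ := exists_lt_of_not_le (lt := lt) (not_le_of_gt (hdesc 0))
  choose f hf using fun i => exists_gt_of_lt hM hA hlt (hmem (i + 1)) (hmem i) (hdesc i) a
  exact convexComponents_infinite_of_descent (lt := lt) (E := fun i => lastEquiv lt (T i)) hSTO
    hstep (fun i => (hreg i).isConvexEquiv)
    (fun i => have := hSTO i; (hreg i).tri_iff) (antitone_nat_of_succ_le fun i => (hdesc i).le) a f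
    hf (hlt.finite_components _ ((hT 0).relDefinable.setOf_right a))

theorem exists_represents_of_iterate (hM : IsSaturated L sort) (hA : IsSmall A)
    (hlt : IsWeaklyOMinimalPair p lt) (i : ℕ) : ∀ {tri : locus p → locus p → Prop}
    (_ : IsRelDefinableLinearOrder p tri)
    (_ : lastEquiv lt ((fun t => ltE t (lastEquiv lt t))^[i] tri) = ⊥),
    ∃ (m : ℕ) (E : Fin (m + 1) → Setoid (locus p)), Represents p lt tri E := by
  have := hlt.linearOrder.isStrictTotalOrder
  have hbase : ∀ {tri : locus p → locus p → Prop}, IsRelDefinableLinearOrder p tri →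
      lastEquiv lt tri = ⊥ →
      ∃ (m : ℕ) (E : Fin (m + 1) → Setoid (locus p)), Represents p lt tri E := by
    intro tri htri h
    have := htri.isStrictTotalOrder
    rw [eq_of_lastEquiv_eq_bot (isRegular_of_isWeaklyOMinimalPair hM hA hlt htri) h]
    exact ⟨0, _, represents_bot hlt⟩
  induction i with
  | zero => exact hbase
  | succ i ih =>
    intro tri htri h
    -- The last relation may be trivial before stage `i + 1`; stopping then is necessary, as
    -- appending `⊥` would not be strictly increasing.
    by_cases hbot : lastEquiv lt tri = ⊥
    · exact hbase htri hbot
    have := htri.isStrictTotalOrder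
    have htri' := IsRelDefinableLinearOrder.ltE_lastEquiv hM hA hlt htri
    obtain ⟨m, E, hE⟩ := ih htri' h
    refine ⟨m + 1, _, hE.snoc (lastEquiv_mem_relDefinableEquivs hM hA hlt htri) ?_⟩
    rw [hE.last_eq hM hA hlt htri']
    exact lastEquiv_ltE_lt
      (fun a => hlt.finite_components _ (htri.relDefinable.setOf_right a))
      (isRegular_of_isWeaklyOMinimalPair hM hA hlt htri)
      (isRegular_of_isWeaklyOMinimalPair hM hA hlt htri') hbot

/-- By regularity, `lastEquiv lt tri ≠ ⊤` says that some right agreement is non-empty, that is, some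
`{x | tri a x}` contains a non-empty final part. -/
theorem sameOrientation_iff (hM : IsSaturated L sort) (hA : IsSmall A)
    (hlt : IsWeaklyOMinimalPair p lt) (htri : IsRelDefinableLinearOrder p tri) :
    SameOrientation p tri lt ↔ lastEquiv lt tri ≠ ⊤ := by
  have := hlt.linearOrder.isStrictTotalOrder
  have := htri.isStrictTotalOrder
  have hreg := isRegular_of_isWeaklyOMinimalPair hM hA hlt htri
  constructor
  · rintro ⟨a, F, ⟨z, hz⟩, hF, hsub⟩ htop
    have haF : a ∉ F := fun ha => irrefl_of tri a (hsub ha)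
    have hle : ∀ y, ¬ lt y z → y ∈ F := by
      intro y hy
      rcases trichotomous_of lt y z with h | rfl | h
      · exact absurd h hy
      · exact hz
      · exact hF hz h
    have haz : lt a z := by_contra fun h => haF (hle a h)
    exact (hreg a z haz).1 (by rw [htop]; trivial) ⟨haz, fun y hy => hsub (hle y hy)⟩
  · intro hne
    obtain ⟨x, y, hxy, -, hE⟩ := exists_lt_of_not_le (lt := lt) (mt top_le_iff.1 hne)
    have hy : y ∈ rightAgreement lt tri x := not_not.1 (mt (hreg x y hxy).2 hE)
    exact ⟨x, rightAgreement lt tri x, ⟨y, hy⟩,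
      fun a b ha hab => rightAgreement_of_not_lt ha (asymm_of lt hab),
      fun z hz => tri_of_mem_rightAgreement hz⟩

end Main

end WeaklyOMinimal

/-- `Represents` does not demand convexity: it is automatic for members of `𝓔_p`, so uniqueness
holds among all strictly increasing sequences from `𝓔_p` starting at the identity. -/
theorem mainTheorem2 {L : FirstOrder.Language.{u, v}} {M : Type w} [L.Structure M]
    {S : Type x} (sort : M → S) (hM : WeaklyOMinimal.IsSaturated L sort)
    (A : Set M) (hA : Cardinal.mk A < Cardinal.mk M)
    {n : ℕ} (p : WeaklyOMinimal.TypeSpace L A n)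
    (lt tri : WeaklyOMinimal.locus p → WeaklyOMinimal.locus p → Prop)
    (hlt : WeaklyOMinimal.IsWeaklyOMinimalPair p lt)
    (htri : WeaklyOMinimal.IsRelDefinableLinearOrder p tri) :
    (∃! E : (m : ℕ) × (Fin (m + 1) → Setoid (WeaklyOMinimal.locus p)),
      WeaklyOMinimal.Represents p lt tri E.2) ∧
    (∀ (m : ℕ) (E : Fin (m + 1) → Setoid (WeaklyOMinimal.locus p)),
      WeaklyOMinimal.Represents p lt tri E →
        (∀ i, WeaklyOMinimal.IsConvexEquiv lt (E i)) ∧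
        (WeaklyOMinimal.SameOrientation p tri lt ↔ E (Fin.last m) ≠ ⊤)) := by
  have hA' : WeaklyOMinimal.IsSmall A := Or.inr hA
  refine ⟨?_, fun m E hE => ⟨hE.isConvexEquiv hM hA' hlt, ?_⟩⟩
  · obtain ⟨i, hi⟩ := WeaklyOMinimal.exists_lastEquiv_iterate_eq_bot hM hA' hlt htri
    obtain ⟨m, E, hE⟩ := WeaklyOMinimal.exists_represents_of_iterate hM hA' hlt i htri hi
    exact ⟨⟨m, E⟩, hE, fun E' hE' => hE'.unique hM hA' hlt htri hE⟩
  · rw [hE.last_eq hM hA' hlt htri]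
    exact WeaklyOMinimal.sameOrientation_iff hM hA' hlt htri
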